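/- Let $\mathbb D$ be the open unit disk and let $H^2(\mathbb D)$ be the Hardy space of functions $f(z)=\sum_{n\ge0}c_nz^n$ on $\mathbb D$ with $\|f\|^2=\sum_{n\ge 0}|c_n|^2<\infty$. A conjugation $C$ on a complex Hilbert space $\mathcal H$ is a conjugate-linear map with $\langle Cx,Cy\rangle=\langle y,x\rangle$ for all $x,y\in\mathcal H$ and $C^2=I$; a bounded operator $T$ on $\mathcal H$ is called $C$-normal if $CT^*TC=TT^*$, and Hermitian if $T^*=T$. Let $p\in\mathbb D\setminus\{0\}$, let $\lambda=\bar p/p$ (so $|\lambda|=1$ and $\lambda p=\bar p$), let $\mu\in\mathbb C$ with $|\mu|=1$, and for $z\in\mathbb D$ put $$J_\mu f(z)=\overline{f(\mu\bar z)},\qquad J=J_1,\qquad \xi_p(z)=\frac{\sqrt{1-|p|^2}}{1-\bar pz},\qquad \tau_p(z)=\frac{\lambda(p-z)}{1-\bar pz},$$ and $W_{\psi,\varphi}f=\psi\cdot(f\circ\varphi)$. **Theorem.** Let $a_0\in\mathbb D$, $a_1,a_2\in\mathbb R$ with $a_2\neq0$, and suppose that $$\varphi(z)=a_0+\frac{a_1z}{1-\bar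 a_0z}$$ maps $\mathbb D$ into itself. Let $$\psi(z)=\frac{a_2}{1-\bar a_0z}.$$ Then $W_{\psi,\varphi}$ is a bounded operator on $H^2(\mathbb D)$, $J_\mu$ and $JW_{\xi_p,\tau_p}$ are conjugations on $H^2(\mathbb D)$, and the following hold. (i) $W_{\psi,\varphi}$ is $J_\mu$-normal and Hermitian if and only if $$(a_0-\bar a_0\mu)(1+a_1-|a_0|^2)=0.$$ (ii) $W_{\psi,\varphi}$ is $JW_{\xi_p,\tau_p}$-normal and Hermitian if and only if $$\bigl[(a_1-|a_0|^2)^2-1\bigr]|p|^2=-(a_1-|a_0|^2+1)\,2\operatorname{Re}(a_0p).$$ -/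

import Mathlib

open scoped ComplexConjugate Complex.UnitDisc InnerProductSpace

noncomputable section

/-- The functions `f(z) = ∑ aₙ zⁿ` on the open unit disc with `∑ |aₙ|² < ∞`. -/
def hardySubmodule : Submodule ℂ (𝔻 → ℂ) where
  carrier := {f | ∃ a : ℕ → ℂ, Summable (fun n => ‖a n‖ ^ 2) ∧
    ∀ z : 𝔻, HasSum (fun n => a n * (z : ℂ) ^ n) (f z)}
  add_mem' := by
    rintro f g ⟨a, ha, hf⟩ ⟨b, hb, hg⟩
    refine ⟨fun n => a n + b n, ?_, fun z => ?_⟩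
    · refine Summable.of_nonneg_of_le (fun n => by positivity) (fun n => ?_)
        ((ha.mul_left 2).add (hb.mul_left 2))
      have h := norm_add_le (a n) (b n)
      have h0 := norm_nonneg (a n + b n)
      nlinarith [sq_nonneg (‖a n‖ - ‖b n‖)]
    · simpa [add_mul] using (hf z).add (hg z)
  zero_mem' := ⟨fun _ => 0, by simp, fun z => by simp⟩
  smul_mem' := by
    rintro c f ⟨a, ha, hf⟩
    refine ⟨fun n => c * a n, ?_, fun z => ?_⟩
    · simpa [mul_pow] using ha.mul_left (‖c‖ ^ 2)
    · simpa [mul_assoc] using (hf z).mul_left c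

/-- The Hardy space `H²(𝔻)`; its elements are functions on the open unit disc. It is a type of its
own so that it carries the `H²` norm and not the topology of pointwise convergence. -/
def HardySpace : Type := hardySubmodule

namespace HardySpace

instance : AddCommGroup HardySpace := inferInstanceAs (AddCommGroup hardySubmodule)
instance : Module ℂ HardySpace := inferInstanceAs (Module ℂ hardySubmodule)
instance : CoeFun HardySpace (fun _ => 𝔻 → ℂ) := ⟨fun f => f.1⟩

theorem exists_coeff (f : HardySpace) : ∃ a : ℕ → ℂ, Summable (fun n => ‖a n‖ ^ 2) ∧
    ∀ z : 𝔻, HasSum (fun n => a n * (z : ℂ) ^ n) (f z) := f.2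

theorem memlp_iff (a : ℕ → ℂ) : Memℓp a 2 ↔ Summable (fun n => ‖a n‖ ^ 2) := by
  rw [memℓp_gen_iff (by norm_num)]
  norm_num

theorem summable_of_lp (a : lp (fun _ : ℕ => ℂ) 2) (z : 𝔻) :
    Summable (fun n => a n * (z : ℂ) ^ n) := by
  have h1 := (memlp_iff a).1 (lp.memℓp a)
  have h2 : Summable (fun n : ℕ => (‖(z : ℂ)‖ ^ 2) ^ n) :=
    summable_geometric_of_lt_one (by positivity) z.sq_norm_lt_one
  refine Summable.of_norm_bounded (h1.add h2) (fun n => ?_)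
  rw [norm_mul, norm_pow, ← pow_mul, mul_comm 2 n, pow_mul]
  nlinarith [sq_nonneg (‖a n‖ - ‖(z : ℂ)‖ ^ n), sq_nonneg ‖a n‖, sq_nonneg (‖(z : ℂ)‖ ^ n)]

/-- The function with a given square-summable sequence of Taylor coefficients. -/
def ofCoeff : lp (fun _ : ℕ => ℂ) 2 →ₗ[ℂ] HardySpace where
  toFun a := ⟨fun z => ∑' n, a n * (z : ℂ) ^ n,
    a, (memlp_iff a).1 (lp.memℓp a), fun z => (summable_of_lp a z).hasSum⟩
  map_add' a b := by
    refine Subtype.ext (funext fun z => ?_)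
    have h := (summable_of_lp a z).tsum_add (summable_of_lp b z)
    simp only [← add_mul] at h
    exact h
  map_smul' c a := by
    refine Subtype.ext (funext fun z => ?_)
    have h := (summable_of_lp a z).tsum_mul_left c
    simp only [← mul_assoc] at h
    exact h

theorem coeff_unique {a : ℕ → ℂ} (h : ∀ z : 𝔻, HasSum (fun n => a n * (z : ℂ) ^ n) 0) :
    a = 0 := by
  have key : HasFPowerSeriesOnBall (fun _ : ℂ => (0 : ℂ))
      (FormalMultilinearSeries.ofScalars ℂ a) 0 1 := by
    refine ⟨?_, one_pos, fun {y} hy => ?_⟩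
    · refine ENNReal.le_of_forall_nnreal_lt fun r hr => ?_
      have hr' : (r : ℝ) < 1 := by exact_mod_cast hr
      refine FormalMultilinearSeries.le_radius_of_summable _ ?_
      have hs := (h (Complex.UnitDisc.mk (r : ℂ) (by simpa using hr'))).summable.norm
      simpa [FormalMultilinearSeries.ofScalars_norm] using hs
    · have hy' : ‖y‖ < 1 := by simpa [← ofReal_norm] using hy
      have hs := h (Complex.UnitDisc.mk y hy')
      simpa [FormalMultilinearSeries.ofScalars_apply_eq, mul_comm] using hs
  have h0 := key.hasFPowerSeriesAt.eq_zero
  funext n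
  have h1 : (FormalMultilinearSeries.ofScalars ℂ a).coeff n = 0 := by rw [h0]; rfl
  simpa using h1

theorem ofCoeff_bijective : Function.Bijective ofCoeff := by
  constructor
  · rw [injective_iff_map_eq_zero]
    intro a ha
    refine lp.ext (coeff_unique fun z => ?_)
    have hz : ∑' n, a n * (z : ℂ) ^ n = 0 := congrFun (congrArg Subtype.val ha) z
    exact hz ▸ (summable_of_lp a z).hasSum
  · intro f
    obtain ⟨a, ha, hf⟩ := exists_coeff f
    exact ⟨⟨a, (memlp_iff a).2 ha⟩, Subtype.ext (funext fun z => (hf z).tsum_eq)⟩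

/-- The sequence of Taylor coefficients of a function in `H²(𝔻)`. -/
def coeff : HardySpace ≃ₗ[ℂ] lp (fun _ : ℕ => ℂ) 2 :=
  (LinearEquiv.ofBijective ofCoeff ofCoeff_bijective).symm

theorem hasSum_coeff (f : HardySpace) (z : 𝔻) :
    HasSum (fun n => coeff f n * (z : ℂ) ^ n) (f z) := by
  have h : ofCoeff (coeff f) = f := (LinearEquiv.ofBijective ofCoeff _).apply_symm_apply f
  have hz : ∑' n, coeff f n * (z : ℂ) ^ n = f z := congrFun (congrArg Subtype.val h) z
  exact hz ▸ (summable_of_lp (coeff f) z).hasSum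

/-- The norm `‖f‖² = ∑ |aₙ|²`. -/
instance : NormedAddCommGroup HardySpace :=
  NormedAddCommGroup.induced HardySpace (lp (fun _ : ℕ => ℂ) 2) coeff coeff.injective

/-- The inner product `⟪f, g⟫ = ∑ conj aₙ * bₙ` (conjugate-linear in the first variable). -/
instance : InnerProductSpace ℂ HardySpace :=
  InnerProductSpace.induced coeff

theorem inner_eq (f g : HardySpace) : ⟪f, g⟫_ℂ = ∑' n, conj (coeff f n) * coeff g n := by
  have h : ⟪f, g⟫_ℂ = ⟪coeff f, coeff g⟫_ℂ := rfl
  rw [h, lp.inner_eq_tsum]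
  simp [mul_comm]

theorem norm_sq_eq (f : HardySpace) : ‖f‖ ^ 2 = ∑' n, ‖coeff f n‖ ^ 2 := by
  have h : ‖f‖ = ‖coeff f‖ := rfl
  have h2 := lp.norm_rpow_eq_tsum (p := 2) (by norm_num) (coeff f)
  rw [h]
  simpa using h2

instance : CompleteSpace HardySpace := by
  have h : Isometry (coeff : HardySpace → lp (fun _ : ℕ => ℂ) 2) :=
    AddMonoidHomClass.isometry_of_norm coeff (fun _ => rfl)
  exact (IsometryEquiv.mk coeff.toEquiv h).completeSpace

end HardySpace

/-- A conjugation on a complex Hilbert space: a conjugate-linear `C` with `⟪C x, C y⟫ = ⟪y, x⟫`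
and `C² = I`. -/
structure Conjugation (H : Type*) [NormedAddCommGroup H] [InnerProductSpace ℂ H] where
  toMap : H →ₗ⋆[ℂ] H
  inner_map_map : ∀ x y, ⟪toMap x, toMap y⟫_ℂ = ⟪y, x⟫_ℂ
  map_map : ∀ x, toMap (toMap x) = x

instance {H : Type*} [NormedAddCommGroup H] [InnerProductSpace ℂ H] :
    CoeFun (Conjugation H) (fun _ => H → H) := ⟨fun C => C.toMap⟩

/-- `T` is `C`-normal: `C T* T C = T T*`. -/
def IsCNormal {H : Type*} [NormedAddCommGroup H] [InnerProductSpace ℂ H] [CompleteSpace H]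
    (C : Conjugation H) (T : H →L[ℂ] H) : Prop :=
  ∀ x, C (ContinuousLinearMap.adjoint T (T (C x))) = T (ContinuousLinearMap.adjoint T x)

/-- `W_{ψ,φ} f = ψ · (f ∘ φ)`, on functions on the disc. -/
def weightedComp (ψ : 𝔻 → ℂ) (φ : 𝔻 → 𝔻) (f : 𝔻 → ℂ) : 𝔻 → ℂ := fun z => ψ z * f (φ z)

/-- `J_μ f(z) = conj (f (μ * conj z))`, on functions on the disc; `J = J_1`. -/
def conjJ (μ : Circle) (f : 𝔻 → ℂ) : 𝔻 → ℂ := fun z => conj (f (μ • star z))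

/-- `ξ_p(z) = √(1 - |p|²) / (1 - conj p * z)`. -/
def xi (p : 𝔻) (z : 𝔻) : ℂ := (√(1 - ‖(p : ℂ)‖ ^ 2) : ℝ) / (1 - conj (p : ℂ) * z)

theorem norm_moebius_lt_one (p z : 𝔻) :
    ‖((p : ℂ) - z) / (1 - conj (p : ℂ) * z)‖ < 1 := by
  have hp : ((p : ℂ).re) * (p : ℂ).re + (p : ℂ).im * (p : ℂ).im < 1 := by
    rw [← Complex.normSq_apply]
    exact p.normSq_lt_one
  have hz : ((z : ℂ).re) * (z : ℂ).re + (z : ℂ).im * (z : ℂ).im < 1 := by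
    rw [← Complex.normSq_apply]
    exact z.normSq_lt_one
  have h : Complex.normSq ((p : ℂ) - z) < Complex.normSq (1 - conj (p : ℂ) * z) := by
    simp only [Complex.normSq_apply, Complex.sub_re, Complex.sub_im, Complex.mul_re,
      Complex.mul_im, Complex.conj_re, Complex.conj_im, Complex.one_re, Complex.one_im]
    nlinarith [mul_pos (sub_pos.2 hp) (sub_pos.2 hz)]
  have h2 : ‖(p : ℂ) - z‖ < ‖1 - conj (p : ℂ) * z‖ := by
    rw [Complex.normSq_eq_norm_sq, Complex.normSq_eq_norm_sq] at h
    exact lt_of_pow_lt_pow_left₀ 2 (norm_nonneg _) h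
  rw [norm_div, div_lt_one (lt_of_le_of_lt (norm_nonneg _) h2)]
  exact h2

/-- `τ_p(z) = lam * (p - z) / (1 - conj p * z)`, an automorphism of the disc. -/
def tau (lam : Circle) (p : 𝔻) (z : 𝔻) : 𝔻 :=
  lam • Complex.UnitDisc.mk (((p : ℂ) - z) / (1 - conj (p : ℂ) * z)) (norm_moebius_lt_one p z)

end

/-! With b = a₁ - |a₀|², the symbol satisfies φ(z)(1 - ā₀z) = a₀ + bz. An adjoint of W must send the
Szegő kernel K_w to conj ψ(w) K_{φ(w)}. Since b and a₂ are real, this rule is symmetric on kernels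
(`weight_mul_szego_comm`), so W is self-adjoint as soon as it is bounded. Boundedness comes from
symmetry: a symmetric map whose iterates grow at most like R^m has norm at most R, and the growth is
controlled by sup |ψ| and a bound 1 - |φ(z)|² ≥ c(1 - |z|²) (`exists_selfAdjoint_weightedComp`,
`exists_schwarzPick_bound`). The conjugations are likewise built on kernels (`exists_conjugation`).

For self-adjoint W, C-normality says that C commutes with W², the weighted composition with weight
ψ·(ψ∘φ) and symbol φ∘φ. Testing on the constant 1 gives an identity of weights, which reduces to one
scalar equation; that equation in turn makes the symbols commute. -/

/-! ### Norm bounds for symmetric maps. -/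

/-- By Cauchy–Schwarz the norms along an orbit are log-convex: successive ratios never decrease, so
a first ratio above R outgrows K R^m. The constant K may depend on x; the conclusion does not. As
`e` need not be injective, `T` need not be known to descend to its range. -/
theorem norm_map_le_of_symmetric_of_iterate_le {E H : Type*} [AddCommGroup E] [Module ℂ E]
    [NormedAddCommGroup H] [InnerProductSpace ℂ H] (e : E →ₗ[ℂ] H) (T : E →ₗ[ℂ] E)
    (hT : ∀ x y, ⟪e (T x), e y⟫_ℂ = ⟪e x, e (T y)⟫_ℂ) (R : ℝ) (hR : 0 < R) (x : E) (K : ℝ)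
    (hK : ∀ m : ℕ, ‖e (T^[m] x)‖ ≤ K * R ^ m) : ‖e (T x)‖ ≤ R * ‖e x‖ := by
  have hconv : ∀ y, ‖e (T y)‖ ^ 2 ≤ ‖e y‖ * ‖e (T (T y))‖ := fun y => by
    have h : ⟪e (T y), e (T y)⟫_ℂ = ⟪e y, e (T (T y))⟫_ℂ := hT y (T y)
    have h2 := norm_inner_le_norm (𝕜 := ℂ) (e y) (e (T (T y)))
    rw [← h, inner_self_eq_norm_sq_to_K] at h2
    simpa using h2
  by_contra! hlt
  have hx : 0 < ‖e x‖ := by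
    rcases (norm_nonneg (e x)).eq_or_lt with h | h
    · have := hconv x
      rw [← h] at this hlt
      nlinarith
    · exact h
  obtain ⟨q, hq⟩ : ∃ q, q = ‖e (T x)‖ / ‖e x‖ := ⟨_, rfl⟩
  have hRq : R < q := by rwa [hq, lt_div_iff₀ hx]
  have hq0 : 0 < q := hR.trans hRq
  have hstep : ∀ m : ℕ, 0 < ‖e (T^[m] x)‖ ∧ q * ‖e (T^[m] x)‖ ≤ ‖e (T^[m + 1] x)‖ := by
    intro m
    induction m with
    | zero => exact ⟨hx, by simp [hq, div_mul_cancel₀ _ hx.ne']⟩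
    | succ m ih =>
      obtain ⟨h0, h1⟩ := ih
      have hc := hconv (T^[m] x)
      simp only [← Function.iterate_succ_apply' (f := T)] at hc
      have hp : 0 < ‖e (T^[m + 1] x)‖ := lt_of_lt_of_le (by positivity) h1
      refine ⟨hp, le_of_mul_le_mul_left ?_ h0⟩
      nlinarith
  have hgrow : ∀ m : ℕ, q ^ m * ‖e x‖ ≤ ‖e (T^[m] x)‖ := by
    intro m
    induction m with
    | zero => simp
    | succ m ih =>
      refine le_trans ?_ (hstep m).2
      rw [pow_succ', mul_assoc]
      gcongr
  have hlim := tendsto_pow_atTop_atTop_of_one_lt ((one_lt_div hR).2 hRq)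
  obtain ⟨m, hm⟩ := (hlim.eventually_gt_atTop (K / ‖e x‖)).exists
  rw [div_pow, div_lt_div_iff₀ hx (by positivity)] at hm
  exact absurd ((hgrow m).trans (hK m)) (not_le.2 hm)

/-! ### Szegő kernels; operators and conjugations defined on them. -/

noncomputable section

namespace HardySpace

theorem memlp_pow (w : 𝔻) : Memℓp (fun n : ℕ => conj (w : ℂ) ^ n) 2 := by
  rw [memlp_iff]
  simp only [norm_pow, RCLike.norm_conj, ← pow_mul, mul_comm _ 2]
  simp only [pow_mul]
  exact summable_geometric_of_lt_one (by positivity) w.sq_norm_lt_one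

/-- The Szegő kernel `K_w(z) = 1 / (1 - conj w * z)`. -/
def szego (w : 𝔻) : HardySpace := coeff.symm ⟨fun n => conj (w : ℂ) ^ n, memlp_pow w⟩

theorem coeff_szego (w : 𝔻) (n : ℕ) : coeff (szego w) n = conj (w : ℂ) ^ n := by
  rw [szego, LinearEquiv.apply_symm_apply]

theorem inner_szego_left (w : 𝔻) (f : HardySpace) : ⟪szego w, f⟫_ℂ = f w := by
  rw [inner_eq, ← (hasSum_coeff f w).tsum_eq]
  simp [coeff_szego, mul_comm]

theorem inner_szego_right (w : 𝔻) (f : HardySpace) : ⟪f, szego w⟫_ℂ = conj (f w) := by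
  rw [← inner_conj_symm, inner_szego_left]

theorem norm_conj_mul_lt_one (w z : 𝔻) : ‖conj (w : ℂ) * z‖ < 1 := by
  rw [norm_mul, RCLike.norm_conj]
  exact mul_lt_one_of_nonneg_of_lt_one_left (norm_nonneg _) w.norm_lt_one z.norm_lt_one.le

theorem szego_apply (w z : 𝔻) : szego w z = (1 - conj (w : ℂ) * z)⁻¹ := by
  rw [← (hasSum_coeff (szego w) z).tsum_eq,
    ← tsum_geometric_of_norm_lt_one (norm_conj_mul_lt_one w z)]
  simp [coeff_szego, mul_pow]

theorem norm_szego_sq (w : 𝔻) : ‖szego w‖ ^ 2 = (1 - ‖(w : ℂ)‖ ^ 2)⁻¹ := by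
  have h := inner_self_eq_norm_sq_to_K (𝕜 := ℂ) (szego w)
  rw [inner_szego_left, szego_apply, Complex.conj_mul'] at h
  exact Complex.ofReal_injective (by simpa using h.symm)

@[ext] theorem ext {f g : HardySpace} (h : ∀ z, f z = g z) : f = g := Subtype.ext (funext h)

/-- The linear combinations of Szegő kernels. -/
def kernelSum : (𝔻 →₀ ℂ) →ₗ[ℂ] HardySpace := Finsupp.linearCombination ℂ szego

@[simp] theorem kernelSum_single (w : 𝔻) (a : ℂ) :
    kernelSum (Finsupp.single w a) = a • szego w := by simp [kernelSum]

theorem denseRange_kernelSum : DenseRange kernelSum := by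
  have h : (LinearMap.range kernelSum).topologicalClosure = ⊤ := by
    rw [Submodule.topologicalClosure_eq_top_iff, Submodule.eq_bot_iff]
    intro f hf
    ext z
    rw [← inner_szego_left]
    exact hf _ ⟨Finsupp.single z 1, by simp⟩
  intro f
  have hf : f ∈ (LinearMap.range kernelSum).topologicalClosure := h ▸ Submodule.mem_top
  exact hf

/-- The map `T` of formal combinations of points with `e_w ↦ conj (ψ w) e_{φ w}`. -/
def pushPoints (ψ : 𝔻 → ℂ) (φ : 𝔻 → 𝔻) : (𝔻 →₀ ℂ) →ₗ[ℂ] (𝔻 →₀ ℂ) :=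
  Finsupp.linearCombination ℂ fun w => Finsupp.single (φ w) (conj (ψ w))

@[simp] theorem pushPoints_single (ψ : 𝔻 → ℂ) (φ : 𝔻 → 𝔻) (w : 𝔻) (a : ℂ) :
    pushPoints ψ φ (Finsupp.single w a) = Finsupp.single (φ w) (a * conj (ψ w)) := by
  simp [pushPoints]

theorem inner_pushPoints {ψ : 𝔻 → ℂ} {φ : 𝔻 → 𝔻}
    (h : ∀ w z, ψ w * szego z (φ w) = conj (ψ z) * szego (φ z) w) (x y : 𝔻 →₀ ℂ) :
    ⟪kernelSum (pushPoints ψ φ x), kernelSum y⟫_ℂ =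
      ⟪kernelSum x, kernelSum (pushPoints ψ φ y)⟫_ℂ := by
  induction x using Finsupp.induction_linear with
  | zero => simp
  | add x₁ x₂ h₁ h₂ => simp only [map_add, inner_add_left, h₁, h₂]
  | single w a =>
    induction y using Finsupp.induction_linear with
    | zero => simp
    | add y₁ y₂ h₁ h₂ => simp only [map_add, inner_add_right, h₁, h₂]
    | single z b =>
      simp only [pushPoints_single, kernelSum_single, inner_smul_left, inner_smul_right,
        inner_szego_left, map_mul, Complex.conj_conj]
      linear_combination b * conj a * h w z

/-- Each application multiplies the coefficient of a point by at most S and the norm of its kernel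
by at most 1/√c; K absorbs the number of points. -/
theorem exists_iterate_pushPoints_le {ψ : 𝔻 → ℂ} {φ : 𝔻 → 𝔻} {S c : ℝ} (hS : ∀ z, ‖ψ z‖ ≤ S)
    (hc : 0 < c) (hφ : ∀ z : 𝔻, c * (1 - ‖(z : ℂ)‖ ^ 2) ≤ 1 - ‖(φ z : ℂ)‖ ^ 2) (x : 𝔻 →₀ ℂ) :
    ∃ K : ℝ, ∀ m : ℕ, ‖kernelSum ((pushPoints ψ φ)^[m] x)‖ ≤ K * (S / √c) ^ m := by
  have hS0 : 0 ≤ S := (norm_nonneg _).trans (hS 0)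
  have hstep : ∀ z, ‖szego (φ z)‖ ≤ ‖szego z‖ / √c := by
    intro z
    have hz : 0 < 1 - ‖(z : ℂ)‖ ^ 2 := sub_pos.2 z.sq_norm_lt_one
    refine le_of_sq_le_sq ?_ (by positivity)
    rw [div_pow, norm_szego_sq, norm_szego_sq, Real.sq_sqrt hc.le, div_eq_mul_inv, ← mul_inv,
      mul_comm]
    exact inv_anti₀ (by positivity) (hφ z)
  have hsingle : ∀ (m : ℕ) (w : 𝔻) (a : ℂ),
      ‖kernelSum ((pushPoints ψ φ)^[m] (Finsupp.single w a))‖ ≤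
        ‖a‖ * ‖szego w‖ * (S / √c) ^ m := by
    intro m
    induction m with
    | zero => intro w a; simp [norm_smul]
    | succ m ih =>
      intro w a
      rw [Function.iterate_succ_apply, pushPoints_single]
      refine (ih _ _).trans ?_
      rw [norm_mul, RCLike.norm_conj, pow_succ]
      calc ‖a‖ * ‖ψ w‖ * ‖szego (φ w)‖ * (S / √c) ^ m
          ≤ ‖a‖ * S * (‖szego w‖ / √c) * (S / √c) ^ m := by
            gcongr
            · exact hS w
            · exact hstep w
        _ = ‖a‖ * ‖szego w‖ * ((S / √c) ^ m * (S / √c)) := by ring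
  induction x using Finsupp.induction_linear with
  | zero => exact ⟨0, fun m => by simp⟩
  | add x y hx hy =>
    obtain ⟨K, hK⟩ := hx
    obtain ⟨K', hK'⟩ := hy
    refine ⟨K + K', fun m => ?_⟩
    simp only [← Module.End.coe_pow, map_add, add_mul] at hK hK' ⊢
    exact (norm_add_le _ _).trans (add_le_add (hK m) (hK' m))
  | single w a => exact ⟨_, fun m => hsingle m w a⟩

theorem exists_selfAdjoint_weightedComp {ψ : 𝔻 → ℂ} {φ : 𝔻 → 𝔻} {S c : ℝ}
    (h : ∀ w z, ψ w * szego z (φ w) = conj (ψ z) * szego (φ z) w) (hS0 : 0 < S)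
    (hS : ∀ z, ‖ψ z‖ ≤ S)
    (hc : 0 < c) (hφ : ∀ z : 𝔻, c * (1 - ‖(z : ℂ)‖ ^ 2) ≤ 1 - ‖(φ z : ℂ)‖ ^ 2) :
    ∃ W : HardySpace →L[ℂ] HardySpace, IsSelfAdjoint W ∧ ∀ f z, W f z = ψ z * f (φ z) := by
  have hbound : ∀ x, ‖(kernelSum ∘ₗ pushPoints ψ φ) x‖ ≤ S / √c * ‖kernelSum x‖ := by
    intro x
    obtain ⟨K, hK⟩ := exists_iterate_pushPoints_le hS hc hφ x
    exact norm_map_le_of_symmetric_of_iterate_le _ _ (inner_pushPoints h) _ (by positivity) x K hK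
  let W := (kernelSum ∘ₗ pushPoints ψ φ).extendOfNorm kernelSum
  have hW : ∀ x, W (kernelSum x) = kernelSum (pushPoints ψ φ x) :=
    LinearMap.extendOfNorm_eq denseRange_kernelSum ⟨_, hbound⟩
  have hsymm : ∀ f g, ⟪W f, g⟫_ℂ = ⟪f, W g⟫_ℂ := fun f g =>
    denseRange_kernelSum.induction_on₂ (p := fun f g => ⟪W f, g⟫_ℂ = ⟪f, W g⟫_ℂ)
      (isClosed_eq (by fun_prop) (by fun_prop))
      (fun x y => by rw [hW, hW, inner_pushPoints h]) f g
  refine ⟨W, ContinuousLinearMap.isSelfAdjoint_iff_isSymmetric.2 hsymm, fun f z => ?_⟩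
  have hz : W (szego z) = conj (ψ z) • szego (φ z) := by
    simpa using hW (Finsupp.single z 1)
  -- The value at z is the pairing with K_z, and symmetry moves W onto the kernel.
  rw [← inner_szego_left, ← hsymm, hz, inner_smul_left, inner_szego_left, Complex.conj_conj]

/-- The conjugate-linear map of formal combinations of points with `e_w ↦ g w K_{σ w}`. -/
def conjKernelSum (g : 𝔻 → ℂ) (σ : 𝔻 → 𝔻) : (𝔻 →₀ ℂ) →ₗ⋆[ℂ] HardySpace where
  toFun x := x.sum fun w a => conj a • g w • szego (σ w)
  map_add' x y := Finsupp.sum_add_index' (by simp) (by simp [add_smul])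
  map_smul' c x := by
    rw [Finsupp.sum_smul_index' (by simp), Finsupp.smul_sum]
    simp [mul_smul]

@[simp] theorem conjKernelSum_single (g : 𝔻 → ℂ) (σ : 𝔻 → 𝔻) (w : 𝔻) (a : ℂ) :
    conjKernelSum g σ (Finsupp.single w a) = conj a • g w • szego (σ w) := by
  change (Finsupp.single w a).sum (fun w a => conj a • g w • szego (σ w)) = _
  rw [Finsupp.sum_single_index]
  simp

theorem inner_conjKernelSum {g : 𝔻 → ℂ} {σ : 𝔻 → 𝔻}
    (h : ∀ w z, conj (g w) * g z * szego (σ z) (σ w) = szego w z) (x y : 𝔻 →₀ ℂ) :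
    ⟪conjKernelSum g σ x, conjKernelSum g σ y⟫_ℂ = ⟪kernelSum y, kernelSum x⟫_ℂ := by
  induction x using Finsupp.induction_linear with
  | zero => simp
  | add x₁ x₂ h₁ h₂ => simp only [map_add, inner_add_left, inner_add_right, h₁, h₂]
  | single w a =>
    induction y using Finsupp.induction_linear with
    | zero => simp
    | add y₁ y₂ h₁ h₂ => simp only [map_add, inner_add_left, inner_add_right, h₁, h₂]
    | single z b =>
      simp only [conjKernelSum_single, kernelSum_single, inner_smul_left, inner_smul_right,
        inner_szego_left, Complex.conj_conj]
      linear_combination a * conj b * h w z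

/-- On kernels C is K_w ↦ g(w) K_{σ(w)}: `h` makes it antiunitary, `hσ` and `hg` make it an
involution. -/
theorem exists_conjugation {g : 𝔻 → ℂ} {σ : 𝔻 → 𝔻} (hσ : ∀ z, σ (σ z) = z)
    (hg : ∀ z, conj (g z) * g (σ z) = 1)
    (h : ∀ w z, conj (g w) * g z * szego (σ z) (σ w) = szego w z) :
    ∃ C : Conjugation HardySpace, ∀ f z, C f z = g z * conj (f (σ z)) := by
  have hbound : ∀ x, ‖conjKernelSum g σ x‖ ≤ 1 * ‖kernelSum x‖ := by
    intro x
    have hx := inner_conjKernelSum h x x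
    rw [inner_self_eq_norm_sq_to_K, inner_self_eq_norm_sq_to_K] at hx
    have hx' : ‖conjKernelSum g σ x‖ ^ 2 = ‖kernelSum x‖ ^ 2 := by exact_mod_cast hx
    rw [one_mul]
    exact le_of_sq_le_sq hx'.le (norm_nonneg _)
  let C := (conjKernelSum g σ).extendOfNorm kernelSum
  have hC : ∀ x, C (kernelSum x) = conjKernelSum g σ x :=
    LinearMap.extendOfNorm_eq denseRange_kernelSum ⟨_, hbound⟩
  have hK : ∀ z, C (szego z) = g z • szego (σ z) := fun z => by
    simpa using hC (Finsupp.single z 1)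
  have hinner : ∀ f k, ⟪C f, C k⟫_ℂ = ⟪k, f⟫_ℂ := fun f k =>
    denseRange_kernelSum.induction_on₂ (p := fun f k => ⟪C f, C k⟫_ℂ = ⟪k, f⟫_ℂ)
      (isClosed_eq (by fun_prop) (by fun_prop))
      (fun x y => by rw [hC, hC, inner_conjKernelSum h]) f k
  have hinv : ∀ f, C (C f) = f := fun f => by
    refine denseRange_kernelSum.induction_on (p := fun f => C (C f) = f) f
      (isClosed_eq (by fun_prop) (by fun_prop)) fun x => ?_
    induction x using Finsupp.induction_linear with
    | zero => simp
    | add x y hx hy => simp only [map_add, hx, hy]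
    | single w a =>
      simp [hK, hσ, smul_smul, hg, mul_assoc]
  refine ⟨⟨C.toLinearMap, hinner, hinv⟩, fun f z => ?_⟩
  change C f z = _
  rw [← inner_szego_left, ← hinv (szego z), hinner, hK, inner_smul_right, inner_szego_right]

end HardySpace
end

/-! ### Estimates and identities for the linear fractional symbol. -/

noncomputable section
namespace HardySpace

theorem one_sub_mul_ne_zero {u v : ℂ} (hu : ‖u‖ < 1) (hv : ‖v‖ < 1) : 1 - u * v ≠ 0 := by
  intro h
  have h1 : ‖u * v‖ = 1 := by rw [← sub_eq_zero.1 h, norm_one]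
  rw [norm_mul] at h1
  nlinarith [norm_nonneg u, norm_nonneg v]

theorem one_sub_conj_mul_ne_zero {u v : ℂ} (hu : ‖u‖ < 1) (hv : ‖v‖ < 1) :
    1 - conj u * v ≠ 0 :=
  one_sub_mul_ne_zero (by rwa [RCLike.norm_conj]) hv

theorem exists_unit_mul_eq_norm (v : ℂ) : ∃ u : ℂ, ‖u‖ = 1 ∧ v * u = ‖v‖ := by
  by_cases h : v = 0
  · exact ⟨1, by simp [h]⟩
  · have hv : (‖v‖ : ℂ) ≠ 0 := by simpa using h
    refine ⟨conj v / ‖v‖, ?_, ?_⟩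
    · rw [norm_div, RCLike.norm_conj, Complex.norm_real, norm_norm, div_self (norm_ne_zero_iff.2 h)]
    · rw [← mul_div_assoc, Complex.mul_conj', sq, mul_div_cancel_right₀ _ hv]

theorem norm_sq_sub_norm_sq (a z : ℂ) (b : ℝ) :
    ‖1 - conj a * z‖ ^ 2 - ‖a + b * z‖ ^ 2 =
      1 - ‖a‖ ^ 2 - 2 * (conj a * (1 + b) * z).re - (b ^ 2 - ‖a‖ ^ 2) * ‖z‖ ^ 2 := by
  simp only [Complex.sq_norm, Complex.normSq_apply, Complex.sub_re, Complex.sub_im, Complex.mul_re,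
    Complex.mul_im, Complex.conj_re, Complex.conj_im, Complex.one_re, Complex.one_im,
    Complex.add_re, Complex.add_im, Complex.ofReal_re, Complex.ofReal_im]
  ring

variable {a : ℂ} {b : ℝ} {φ : 𝔻 → 𝔻}

/-- On the radius where the real part in `norm_sq_sub_norm_sq` equals its modulus, |φ| < 1 gives an
inequality in t = |z|; let t → 1. -/
theorem norm_conj_mul_one_add_le
    (hφ : ∀ z : 𝔻, (φ z : ℂ) * (1 - conj a * z) = a + b * z) :
    2 * (‖a‖ * |1 + b|) ≤ 1 - b ^ 2 := by
  obtain ⟨u, hu, hv⟩ := exists_unit_mul_eq_norm (conj a * (1 + b))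
  have hnorm : ‖conj a * (1 + b)‖ = ‖a‖ * |1 + b| := by
    rw [norm_mul, RCLike.norm_conj, ← Complex.ofReal_one, ← Complex.ofReal_add, Complex.norm_real,
      Real.norm_eq_abs]
  have key : ∀ t ∈ Set.Ioo (0 : ℝ) 1,
      0 ≤ 1 - ‖a‖ ^ 2 - 2 * (‖a‖ * |1 + b| * t) - (b ^ 2 - ‖a‖ ^ 2) * t ^ 2 := by
    intro t ht
    have hn : ‖u * t‖ = t := by
      rw [norm_mul, hu, one_mul, Complex.norm_real, Real.norm_of_nonneg ht.1.le]
    have h := norm_sq_sub_norm_sq a (u * t) b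
    have hz := hφ (Complex.UnitDisc.mk (u * t) (by rw [hn]; exact ht.2))
    rw [Complex.UnitDisc.coe_mk] at hz
    rw [← mul_assoc (conj a * (1 + b)) u, hv, hn, ← Complex.ofReal_mul, Complex.ofReal_re, hnorm] at h
    rw [← hz, norm_mul, mul_pow] at h
    have := (φ (Complex.UnitDisc.mk (u * t) (by rw [hn]; exact ht.2))).sq_norm_lt_one
    nlinarith [sq_nonneg ‖1 - conj a * (u * t)‖]
  have hlim : (1 : ℝ) ∈ closure (Set.Ioo (0 : ℝ) 1) := by
    rw [closure_Ioo (by norm_num)]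
    simp
  have h1 := closure_minimal (t := {t : ℝ |
      0 ≤ 1 - ‖a‖ ^ 2 - 2 * (‖a‖ * |1 + b| * t) - (b ^ 2 - ‖a‖ ^ 2) * t ^ 2}) key
    (isClosed_le (by fun_prop) (by fun_prop)) hlim
  rw [Set.mem_ofPred_eq] at h1
  linarith

/-- With t = |z|, A = 1 - |a|² and D = b² - |a|², the preceding bound gives (1 - |φ(z)|²)|1 - āz|² ≥
(1 - t)(A + Dt). The last factor is affine in t, hence at least m = min(A, A + D) > 0. -/
theorem exists_schwarzPick_bound (ha : ‖a‖ < 1)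
    (hφ : ∀ z : 𝔻, (φ z : ℂ) * (1 - conj a * z) = a + b * z) :
    ∃ c : ℝ, 0 < c ∧ ∀ z : 𝔻, c * (1 - ‖(z : ℂ)‖ ^ 2) ≤ 1 - ‖(φ z : ℂ)‖ ^ 2 := by
  have hb := norm_conj_mul_one_add_le hφ
  have ha0 := norm_nonneg a
  have hb1 : 0 ≤ 1 - b ^ 2 := le_trans (by positivity) hb
  have hb2 : 0 ≤ 1 + b := by nlinarith
  rw [abs_of_nonneg hb2] at hb
  have hA : 0 < 1 - ‖a‖ ^ 2 := by nlinarith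
  have hAD : 0 < 1 - ‖a‖ ^ 2 + (b ^ 2 - ‖a‖ ^ 2) := by
    rcases hb2.eq_or_lt with h | h
    · nlinarith
    · have h3 : 2 * ‖a‖ ≤ 1 - b := le_of_mul_le_mul_right (by nlinarith) h
      nlinarith
  obtain ⟨m, hm, hmA, hmD⟩ : ∃ m : ℝ, 0 < m ∧ m ≤ 1 - ‖a‖ ^ 2 ∧
      m ≤ 1 - ‖a‖ ^ 2 + (b ^ 2 - ‖a‖ ^ 2) :=
    ⟨_, lt_min hA hAD, min_le_left _ _, min_le_right _ _⟩
  -- The 8 is 4 · 2, from |1 - āz|² ≤ 4 and 1 - t² ≤ 2(1 - t).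
  refine ⟨m / 8, by positivity, fun z => ?_⟩
  have hz0 := norm_nonneg (z : ℂ)
  have hz1 := z.norm_lt_one
  have hre : (conj a * (1 + b) * z).re ≤ ‖a‖ * (1 + b) * ‖(z : ℂ)‖ := by
    refine (Complex.re_le_norm _).trans ?_
    rw [norm_mul, norm_mul, RCLike.norm_conj, ← Complex.ofReal_one, ← Complex.ofReal_add,
      Complex.norm_real, Real.norm_of_nonneg hb2]
  have hQ := norm_sq_sub_norm_sq a z b
  rw [← hφ z, norm_mul, mul_pow] at hQ
  have hden : ‖1 - conj a * z‖ ^ 2 ≤ 4 := by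
    have h1 : ‖1 - conj a * z‖ ≤ 1 + ‖a‖ * ‖(z : ℂ)‖ := by
      refine (norm_sub_le _ _).trans ?_
      rw [norm_one, norm_mul, RCLike.norm_conj]
    have h2 : ‖1 - conj a * z‖ ≤ 2 := by nlinarith
    nlinarith [norm_nonneg (1 - conj a * z)]
  have hφz := (φ z).sq_norm_lt_one
  have h1 : (1 - ‖(z : ℂ)‖) * m ≤
      (1 - ‖(z : ℂ)‖) * (1 - ‖a‖ ^ 2 + (b ^ 2 - ‖a‖ ^ 2) * ‖(z : ℂ)‖) :=
    mul_le_mul_of_nonneg_left (by nlinarith) (by linarith)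
  have h2 : (1 - ‖(z : ℂ)‖) * m ≤ 4 * (1 - ‖(φ z : ℂ)‖ ^ 2) := by
    nlinarith [mul_le_mul_of_nonneg_right hb hz0]
  have h3 : m * (1 - ‖(z : ℂ)‖ ^ 2) ≤ m * (2 * (1 - ‖(z : ℂ)‖)) :=
    mul_le_mul_of_nonneg_left (by nlinarith) hm.le
  linarith

/-- Both sides are s / (1 - āw - a z̄ - b z̄ w), because s and b are real. -/
theorem weight_mul_szego_comm {ψ : 𝔻 → ℂ} {s : ℝ}
    (hφ : ∀ z : 𝔻, (φ z : ℂ) * (1 - conj a * z) = a + b * z)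
    (hψ : ∀ z : 𝔻, ψ z = s / (1 - conj a * z)) (w z : 𝔻) :
    ψ w * szego z (φ w) = conj (ψ z) * szego (φ z) w := by
  have h1 := hφ w
  have h2 := congrArg conj (hφ z)
  simp only [map_mul, map_sub, map_one, map_add, Complex.conj_conj, Complex.conj_ofReal] at h2
  rw [szego_apply, szego_apply, hψ, hψ, map_div₀, Complex.conj_ofReal, ← div_eq_mul_inv,
    ← div_eq_mul_inv, div_div, div_div]
  congr 1
  simp only [map_mul, map_sub, map_one, Complex.conj_conj]
  linear_combination (-conj (z : ℂ)) * h1 + (w : ℂ) * h2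

theorem weight_mul_weight_comp {ψ : 𝔻 → ℂ} {s : ℂ}
    (hφ : ∀ z : 𝔻, (φ z : ℂ) * (1 - conj a * z) = a + b * z)
    (hψ : ∀ z : 𝔻, ψ z = s / (1 - conj a * z)) (z : 𝔻) :
    ψ z * ψ (φ z) = s ^ 2 / (1 - conj a * a - conj a * (1 + b) * z) := by
  rw [hψ, hψ, div_mul_div_comm, ← sq]
  congr 1
  linear_combination (-conj a) * hφ z

theorem sq_denom_ne_zero (ha : ‖a‖ < 1)
    (hφ : ∀ z : 𝔻, (φ z : ℂ) * (1 - conj a * z) = a + b * z) (z : 𝔻) :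
    1 - conj a * a - conj a * (1 + b) * (z : ℂ) ≠ 0 := by
  have h : 1 - conj a * a - conj a * (1 + b) * (z : ℂ) =
      (1 - conj a * z) * (1 - conj a * φ z) := by
    linear_combination conj a * hφ z
  rw [h]
  exact mul_ne_zero (one_sub_conj_mul_ne_zero ha z.norm_lt_one)
    (one_sub_conj_mul_ne_zero ha (φ z).norm_lt_one)

theorem comp_self_mul (hφ : ∀ z : 𝔻, (φ z : ℂ) * (1 - conj a * z) = a + b * z) (z : 𝔻) :
    (φ (φ z) : ℂ) * (1 - conj a * a - conj a * (1 + b) * (z : ℂ)) =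
      a * (1 + b) + (b ^ 2 - conj a * a) * z := by
  linear_combination (1 - conj a * z) * hφ (φ z) + (b + conj a * φ (φ z)) * hφ z

/-! ### C-normality of a self-adjoint weighted composition operator. -/

theorem isCNormal_iff_commute {H : Type*} [NormedAddCommGroup H] [InnerProductSpace ℂ H]
    [CompleteSpace H] (C : Conjugation H) {T : H →L[ℂ] H} (hT : IsSelfAdjoint T) :
    IsCNormal C T ↔ ∀ x, C (T (T x)) = T (T (C x)) := by
  have h : ContinuousLinearMap.adjoint T = T := hT
  rw [IsCNormal, h]
  constructor
  · intro hC x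
    rw [← hC, C.map_map]
  · intro hC x
    rw [hC, C.map_map]

section commute

variable {C : Conjugation HardySpace} {W : HardySpace →L[ℂ] HardySpace} {g ψ : 𝔻 → ℂ}
  {σ φ : 𝔻 → 𝔻}

theorem IsCNormal.weight_eq (hT : IsSelfAdjoint W) (hW : ∀ f z, W f z = ψ z * f (φ z))
    (hC : ∀ f z, C f z = g z * conj (f (σ z))) (h : IsCNormal C W) (z : 𝔻) :
    g z * conj (ψ (σ z) * ψ (φ (σ z))) = ψ z * ψ (φ z) * g (φ (φ z)) := by
  -- `szego 0` is the constant function 1, so only the weights remain.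
  have h1 := congrArg (fun f : HardySpace => f z) ((isCNormal_iff_commute C hT).1 h (szego 0))
  simpa [hW, hC, szego_apply, mul_assoc] using h1

theorem isCNormal_of_weight_eq (hT : IsSelfAdjoint W) (hW : ∀ f z, W f z = ψ z * f (φ z))
    (hC : ∀ f z, C f z = g z * conj (f (σ z)))
    (hg : ∀ z, g z * conj (ψ (σ z) * ψ (φ (σ z))) = ψ z * ψ (φ z) * g (φ (φ z)))
    (hσ : ∀ z, φ (φ (σ z)) = σ (φ (φ z))) : IsCNormal C W := by
  refine (isCNormal_iff_commute C hT).2 fun f => ?_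
  ext z
  have h := hg z
  rw [map_mul] at h
  rw [hC, hW, hW, hW, hW, hC, map_mul, map_mul, hσ]
  linear_combination conj (f (σ (φ (φ z)))) * h

end commute

/-! ### The two conjugations. -/

theorem exists_conjugation_conjJ (μ : Circle) :
    ∃ C : Conjugation HardySpace, ∀ f z, C f z = 1 * conj (f (μ • star z)) := by
  have hμ : conj (μ : ℂ) * μ = 1 := by
    rw [Complex.conj_mul', Circle.norm_coe]; norm_num
  refine exists_conjugation (g := fun _ => 1) (σ := fun z => μ • star z) (fun z => ?_)
    (fun z => by simp) fun w z => ?_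
  · refine Complex.UnitDisc.coe_injective ?_
    simp only [Complex.UnitDisc.coe_circle_smul, Complex.UnitDisc.coe_star, map_mul,
      Complex.conj_conj]
    linear_combination (z : ℂ) * hμ
  · rw [szego_apply, szego_apply]
    simp only [Complex.UnitDisc.coe_circle_smul, Complex.UnitDisc.coe_star, map_mul,
      Complex.conj_conj, map_one, one_mul]
    congr 1
    linear_combination (-(z : ℂ) * conj (w : ℂ)) * hμ

section moebius

variable {p : 𝔻} {lam : Circle}

theorem tau_star_mul (hlam : (lam : ℂ) * p = conj (p : ℂ)) (z : 𝔻) :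
    (tau lam p (star z) : ℂ) * (1 - conj (p : ℂ) * conj (z : ℂ)) =
      conj (p : ℂ) - lam * conj (z : ℂ) := by
  have h := one_sub_conj_mul_ne_zero p.norm_lt_one (star z).norm_lt_one
  rw [tau, Complex.UnitDisc.coe_circle_smul, Complex.UnitDisc.coe_mk]
  rw [Complex.UnitDisc.coe_star] at h ⊢
  rw [mul_assoc, div_mul_cancel₀ _ h]
  linear_combination hlam

theorem conj_tau_star_mul (hlam : (lam : ℂ) * p = conj (p : ℂ)) (z : 𝔻) :
    conj (tau lam p (star z) : ℂ) * (1 - p * z) = p - conj (lam : ℂ) * z := by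
  simpa using congrArg conj (tau_star_mul hlam z)

theorem conj_xi_star (p z : 𝔻) :
    conj (xi p (star z)) = (√(1 - ‖(p : ℂ)‖ ^ 2) : ℝ) / (1 - p * z) := by
  simp [xi]

theorem sqrt_mul_sqrt (p : 𝔻) :
    ((√(1 - ‖(p : ℂ)‖ ^ 2) : ℝ) : ℂ) * (√(1 - ‖(p : ℂ)‖ ^ 2) : ℝ) = 1 - p * conj (p : ℂ) := by
  rw [← Complex.ofReal_mul, Real.mul_self_sqrt (sub_nonneg.2 p.sq_norm_lt_one.le),
    Complex.mul_conj']
  push_cast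
  ring

theorem sqrt_ne_zero (p : 𝔻) : ((√(1 - ‖(p : ℂ)‖ ^ 2) : ℝ) : ℂ) ≠ 0 := by
  rw [Complex.ofReal_ne_zero]
  exact (Real.sqrt_pos.2 (sub_pos.2 p.sq_norm_lt_one)).ne'

theorem conj_lam_mul (lam : Circle) : conj (lam : ℂ) * lam = 1 := by
  rw [Complex.conj_mul', Circle.norm_coe]; norm_num

theorem conj_lam_mul_conj (hlam : (lam : ℂ) * p = conj (p : ℂ)) :
    conj (lam : ℂ) * conj (p : ℂ) = p := by
  simpa using congrArg conj hlam

/-- The condition λp = p̄ is what makes z ↦ τ_p(z̄) an involution; the square root in ξ_p supplies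
the factor 1 - |p|² of the Möbius kernel identity. -/
theorem exists_conjugation_conjJ_weightedComp (hlam : (lam : ℂ) * p = conj (p : ℂ)) :
    ∃ C : Conjugation HardySpace, ∀ f z,
      C f z = conj (xi p (star z)) * conj (f (tau lam p (star z))) := by
  have hl := conj_lam_mul lam
  have hlc := conj_lam_mul_conj hlam
  have hs := sqrt_mul_sqrt p
  have hp1 : (1 : ℂ) - p * conj (p : ℂ) ≠ 0 := by
    rw [mul_comm]; exact one_sub_conj_mul_ne_zero p.norm_lt_one p.norm_lt_one
  refine exists_conjugation (g := fun z => conj (xi p (star z)))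
    (σ := fun z => tau lam p (star z)) (fun z => ?_) (fun z => ?_) fun w z => ?_
  · refine Complex.UnitDisc.coe_injective ?_
    have h1 := tau_star_mul hlam (tau lam p (star z))
    have h2 := conj_tau_star_mul hlam z
    refine mul_right_cancel₀ hp1 ?_
    linear_combination (1 - p * z) * h1
      + (conj (p : ℂ) * tau lam p (star (tau lam p (star z))) - lam) * h2
      - (tau lam p (star (tau lam p (star z))) * z) * hlc
      + z * hl - hlam
  · rw [conj_xi_star, conj_xi_star, map_div₀, Complex.conj_ofReal, div_mul_div_comm, hs]
    have h1 := tau_star_mul hlam z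
    rw [div_eq_one_iff_eq]
    · simp only [map_sub, map_one, map_mul]
      linear_combination p * h1 - conj (z : ℂ) * hlam
    · refine mul_ne_zero ?_ (one_sub_mul_ne_zero p.norm_lt_one (Complex.UnitDisc.norm_lt_one _))
      rw [map_ne_zero]
      exact one_sub_mul_ne_zero p.norm_lt_one z.norm_lt_one
  · rw [conj_xi_star, conj_xi_star, map_div₀, Complex.conj_ofReal, div_mul_div_comm, hs,
      szego_apply, szego_apply, ← div_eq_mul_inv, div_div, inv_eq_one_div, div_eq_div_iff]
    · simp only [map_sub, map_one, map_mul]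
      have h1 := tau_star_mul hlam w
      have h2 := conj_tau_star_mul hlam z
      linear_combination (conj (tau lam p (star z) : ℂ) * (1 - p * z)) * h1
        + (conj (p : ℂ) - lam * conj (w : ℂ)) * h2 + z * conj (w : ℂ) * hl
        - z * hlc - conj (w : ℂ) * hlam
    · refine mul_ne_zero (mul_ne_zero ?_ (one_sub_mul_ne_zero p.norm_lt_one z.norm_lt_one))
        (one_sub_conj_mul_ne_zero (Complex.UnitDisc.norm_lt_one _) (Complex.UnitDisc.norm_lt_one _))
      rw [map_ne_zero]
      exact one_sub_mul_ne_zero p.norm_lt_one w.norm_lt_one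
    · exact one_sub_conj_mul_ne_zero w.norm_lt_one z.norm_lt_one

end moebius
end HardySpace
end

/-! ### Scalar criteria for C-normality. -/

noncomputable section
namespace HardySpace
section criteria

variable {a : ℂ} {b : ℝ} {s : ℂ} {φ : 𝔻 → 𝔻} {ψ : 𝔻 → ℂ} {C : Conjugation HardySpace}
  {W : HardySpace →L[ℂ] HardySpace}

/-- Here p is only a nonzero test point: once denominators are cleared, the weight identity is z
times a constant equation. -/
theorem isCNormal_conjJ_iff {μ : Circle} {p : 𝔻} (hp : p ≠ 0) (ha : ‖a‖ < 1) (hs : s ≠ 0)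
    (hs' : conj s = s)
    (hφ : ∀ z : 𝔻, (φ z : ℂ) * (1 - conj a * z) = a + b * z)
    (hψ : ∀ z : 𝔻, ψ z = s / (1 - conj a * z))
    (hT : IsSelfAdjoint W) (hW : ∀ f z, W f z = ψ z * f (φ z))
    (hC : ∀ f z, C f z = 1 * conj (f (μ • star z))) :
    IsCNormal C W ↔ (a - conj a * μ) * (1 + b) = 0 := by
  have hp' : (p : ℂ) ≠ 0 := Complex.UnitDisc.coe_eq_zero.not.2 hp
  have hμ := conj_lam_mul μ
  have hd := sq_denom_ne_zero ha hφ
  have hΨ := weight_mul_weight_comp hφ hψ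
  constructor
  · intro h
    have h1 := IsCNormal.weight_eq (g := fun _ => 1) (σ := fun z => μ • star z) hT hW hC h p
    rw [hΨ, hΨ, map_div₀, map_pow, hs', mul_one, one_mul,
      div_eq_div_iff ((map_ne_zero _).2 (hd _)) (hd _)] at h1
    have h2 := mul_left_cancel₀ (pow_ne_zero 2 hs) h1
    simp only [Complex.UnitDisc.coe_circle_smul, Complex.UnitDisc.coe_star, map_mul, map_sub,
      map_add, Complex.conj_conj, Complex.conj_ofReal, map_one] at h2
    refine mul_right_cancel₀ hp' ?_
    linear_combination μ * h2 - a * (1 + b) * p * hμ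
  · intro h
    have hnum := comp_self_mul hφ
    have h' : (conj a - a * conj (μ : ℂ)) * (1 + b) = 0 := by simpa using congrArg conj h
    refine isCNormal_of_weight_eq (g := fun _ => 1) (σ := fun z => μ • star z) hT hW hC
      (fun z => ?_) fun z => ?_
    · rw [hΨ, hΨ, map_div₀, map_pow, hs', mul_one, one_mul]
      congr 1
      simp only [Complex.UnitDisc.coe_circle_smul, Complex.UnitDisc.coe_star, map_mul, map_sub,
        map_add, Complex.conj_conj, Complex.conj_ofReal, map_one]
      linear_combination z * h'
    · refine Complex.UnitDisc.coe_injective (mul_right_cancel₀ (hd (μ • star z)) ?_)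
      rw [hnum]
      have h1 := congrArg conj (hnum z)
      simp only [Complex.UnitDisc.coe_circle_smul, Complex.UnitDisc.coe_star, map_mul, map_sub,
        map_add, Complex.conj_conj, Complex.conj_ofReal, map_one, map_pow] at h1 ⊢
      linear_combination (-μ : ℂ) * h1 + h - μ * conj (φ (φ z) : ℂ) * conj (z : ℂ) * h

theorem isCNormal_conjJ_weightedComp_iff {lam : Circle} {p : 𝔻} (hp : p ≠ 0)
    (hlam : (lam : ℂ) * p = conj (p : ℂ)) (ha : ‖a‖ < 1) (hs : s ≠ 0) (hs' : conj s = s)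
    (hφ : ∀ z : 𝔻, (φ z : ℂ) * (1 - conj a * z) = a + b * z)
    (hψ : ∀ z : 𝔻, ψ z = s / (1 - conj a * z))
    (hT : IsSelfAdjoint W) (hW : ∀ f z, W f z = ψ z * f (φ z))
    (hC : ∀ f z, C f z = conj (xi p (star z)) * conj (f (tau lam p (star z)))) :
    IsCNormal C W ↔ (1 + b) * (a * conj (lam : ℂ) + conj a) = p * (1 - (b : ℂ) ^ 2) := by
  have hp' : (p : ℂ) ≠ 0 := Complex.UnitDisc.coe_eq_zero.not.2 hp
  have hl := conj_lam_mul lam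
  have hlc := conj_lam_mul_conj hlam
  have hd := sq_denom_ne_zero ha hφ
  have hd' : ∀ z : 𝔻, 1 - a * conj a - a * (1 + b) * conj (z : ℂ) ≠ 0 := fun z => by
    simpa using (map_ne_zero (starRingEnd ℂ)).2 (hd z)
  have hΨ := weight_mul_weight_comp hφ hψ
  have hnum := comp_self_mul hφ
  have hτ := conj_tau_star_mul hlam
  have hpz : ∀ z : 𝔻, 1 - (p : ℂ) * z ≠ 0 := fun z =>
    one_sub_mul_ne_zero p.norm_lt_one z.norm_lt_one
  -- Clearing denominators, the terms free of z cancel, so any single z ≠ 0 decides the identity.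
  have hweight : ∀ z : 𝔻, (conj (xi p (star z)) *
      conj (ψ (tau lam p (star z)) * ψ (φ (tau lam p (star z)))) =
        ψ z * ψ (φ z) * conj (xi p (star (φ (φ z))))) ↔
      (z : ℂ) * ((1 + b) * (a * conj (lam : ℂ) + conj a)) =
        (z : ℂ) * (p * (1 - (b : ℂ) ^ 2)) := by
    intro z
    rw [hΨ, hΨ, conj_xi_star, conj_xi_star, map_div₀, map_pow, hs', div_mul_div_comm,
      div_mul_div_comm, mul_comm (s ^ 2)]
    simp only [map_mul, map_sub, map_add, Complex.conj_conj, Complex.conj_ofReal, map_one]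
    rw [div_eq_div_iff (mul_ne_zero (hpz z) (hd' _)) (mul_ne_zero (hd z) (hpz _)),
      mul_right_inj' (mul_ne_zero (sqrt_ne_zero p) (pow_ne_zero 2 hs))]
    constructor
    · intro h
      linear_combination -h - p * hnum z + a * (1 + b) * hτ z
    · intro h
      linear_combination -h - p * hnum z + a * (1 + b) * hτ z
  constructor
  · intro h
    refine mul_left_cancel₀ hp' ((hweight p).1 ?_)
    exact IsCNormal.weight_eq (g := fun z => conj (xi p (star z)))
      (σ := fun z => tau lam p (star z)) hT hW hC h p
  · intro h
    have h' : (1 + b) * (conj a * lam + a) = conj (p : ℂ) * (1 - (b : ℂ) ^ 2) := by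
      simpa using congrArg conj h
    refine isCNormal_of_weight_eq (g := fun z => conj (xi p (star z)))
      (σ := fun z => tau lam p (star z)) hT hW hC (fun z => (hweight z).2 (by rw [h])) fun z => ?_
    have hpz' : 1 - conj (p : ℂ) * conj (z : ℂ) ≠ 0 := by
      simpa using (map_ne_zero (starRingEnd ℂ)).2 (hpz z)
    have h1 := congrArg conj (hnum z)
    have h2 := hnum (tau lam p (star z))
    have h3 := tau_star_mul hlam z
    have h4 := tau_star_mul hlam (φ (φ z))
    simp only [map_mul, map_sub, map_add, Complex.conj_conj, Complex.conj_ofReal, map_one,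
      map_pow] at h1
    -- The scalar condition matches the denominators of φ∘φ∘σ and σ∘φ∘φ, where σ(z) = τ_p(z̄).
    have hD : (1 - conj a * a - conj a * (1 + b) * tau lam p (star z)) *
        (1 - conj (p : ℂ) * conj (z : ℂ)) = (1 - conj (p : ℂ) * conj (φ (φ z) : ℂ)) *
          (1 - a * conj a - a * (1 + b) * conj (z : ℂ)) := by
      linear_combination (-conj a * (1 + b)) * h3 + conj (p : ℂ) * h1 + conj (z : ℂ) * h'
    refine Complex.UnitDisc.coe_injective (mul_right_cancel₀ (mul_ne_zero
      (hd (tau lam p (star z))) hpz') ?_)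
    linear_combination (1 - conj (p : ℂ) * conj (z : ℂ)) * h2 + (b ^ 2 - conj a * a) * h3
      - tau lam p (star (φ (φ z))) * hD
      - (1 - a * conj a - a * (1 + b) * conj (z : ℂ)) * h4 + lam * h1 + h'

end criteria
end HardySpace
end

/-! ### The theorem in its original parameters. -/

theorem mainTheorem7 (p : 𝔻) (hp : p ≠ 0) (lam : Circle) (hlam : (lam : ℂ) * p = conj (p : ℂ))
    (μ : Circle) (a₀ : ℂ) (ha₀ : ‖a₀‖ < 1) (a₁ a₂ : ℝ) (ha₂ : a₂ ≠ 0)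
    (φ : 𝔻 → 𝔻) (hφ : ∀ z : 𝔻, (φ z : ℂ) = a₀ + a₁ * z / (1 - conj a₀ * z))
    (ψ : 𝔻 → ℂ) (hψ : ∀ z : 𝔻, ψ z = a₂ / (1 - conj a₀ * z)) :
    ∃ (W : HardySpace →L[ℂ] HardySpace) (Jμ JW : Conjugation HardySpace),
      (∀ f : HardySpace, (W f : 𝔻 → ℂ) = weightedComp ψ φ f) ∧
      (∀ f : HardySpace, (Jμ f : 𝔻 → ℂ) = conjJ μ f) ∧
      (∀ f : HardySpace, (JW f : 𝔻 → ℂ) = conjJ 1 (weightedComp (xi p) (tau lam p) f)) ∧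
      ((IsCNormal Jμ W ∧ IsSelfAdjoint W) ↔
        (a₀ - conj a₀ * μ) * (1 + a₁ - (‖a₀‖ : ℂ) ^ 2) = 0) ∧
      ((IsCNormal JW W ∧ IsSelfAdjoint W) ↔
        ((a₁ - ‖a₀‖ ^ 2) ^ 2 - 1) * ‖(p : ℂ)‖ ^ 2 =
          -(a₁ - ‖a₀‖ ^ 2 + 1) * (2 * (a₀ * p).re)) := by
  have hφ' : ∀ z : 𝔻, (φ z : ℂ) * (1 - conj a₀ * z) = a₀ + ((a₁ - ‖a₀‖ ^ 2 : ℝ) : ℂ) * z := by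
    intro z
    have hz := HardySpace.one_sub_conj_mul_ne_zero ha₀ z.norm_lt_one
    rw [hφ, add_mul, div_mul_cancel₀ _ hz]
    push_cast
    rw [← Complex.mul_conj']
    ring
  obtain ⟨c, hc, hcφ⟩ := HardySpace.exists_schwarzPick_bound ha₀ hφ'
  have hψS : ∀ z, ‖ψ z‖ ≤ |a₂| / (1 - ‖a₀‖) := by
    intro z
    rw [hψ, norm_div, Complex.norm_real, Real.norm_eq_abs]
    have h1 : 1 - ‖a₀‖ ≤ ‖1 - conj a₀ * z‖ := by
      have h2 := norm_sub_norm_le 1 (conj a₀ * z)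
      rw [norm_one, norm_mul, RCLike.norm_conj] at h2
      nlinarith [norm_nonneg a₀, z.norm_lt_one]
    have h3 := sub_pos.2 ha₀
    gcongr
  obtain ⟨W, hT, hW⟩ := HardySpace.exists_selfAdjoint_weightedComp
    (HardySpace.weight_mul_szego_comm hφ' hψ)
    (div_pos (abs_pos.2 ha₂) (sub_pos.2 ha₀)) hψS hc hcφ
  obtain ⟨Jμ, hJ⟩ := HardySpace.exists_conjugation_conjJ μ
  obtain ⟨JW, hJW⟩ := HardySpace.exists_conjugation_conjJ_weightedComp hlam
  have ha₂' : (a₂ : ℂ) ≠ 0 := Complex.ofReal_ne_zero.2 ha₂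
  refine ⟨W, Jμ, JW, fun f => funext (hW f), fun f => funext fun z => ?_,
    fun f => funext fun z => ?_, ?_, ?_⟩
  · rw [hJ, one_mul, conjJ]
  · rw [hJW, conjJ, weightedComp, one_smul, map_mul]
  · rw [and_iff_left hT, HardySpace.isCNormal_conjJ_iff hp ha₀ ha₂' (Complex.conj_ofReal _) hφ' hψ
      hT hW hJ]
    push_cast
    rw [add_sub_assoc]
  · rw [and_iff_left hT, HardySpace.isCNormal_conjJ_weightedComp_iff hp hlam ha₀ ha₂'
      (Complex.conj_ofReal _) hφ' hψ hT hW hJW]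
    have hp' : conj (p : ℂ) ≠ 0 := (map_ne_zero _).2 (Complex.UnitDisc.coe_eq_zero.not.2 hp)
    have hlc := HardySpace.conj_lam_mul_conj hlam
    have hre : ((2 * (a₀ * p).re : ℝ) : ℂ) = a₀ * p + conj a₀ * conj (p : ℂ) := by
      rw [← map_mul, Complex.add_conj]
    have hpp : ((‖(p : ℂ)‖ ^ 2 : ℝ) : ℂ) = p * conj (p : ℂ) := by
      rw [Complex.mul_conj']; push_cast; rfl
    -- Multiplying by p̄ and using λ̄p̄ = p turns the complex criterion into an equation between
    -- real quantities.
    rw [← mul_left_inj' hp', ← Complex.ofReal_inj, Complex.ofReal_mul, Complex.ofReal_mul, hre, hpp]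
    generalize a₁ - ‖a₀‖ ^ 2 = b
    push_cast
    constructor <;> intro h
    · linear_combination h - (1 + b) * a₀ * hlc
    · linear_combination h + (1 + b) * a₀ * hlc
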